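/- Let $\omega=-\tfrac12+\mathbf{i}\tfrac{\sqrt3}{2}$, and for $a\in\mathbb{C}$ with $|a|=1$ let \[H_9^{(1)}(a)=\left[ \begin{array}{ccc|ccc|ccc} 1 & 1 & 1 & 1 & 1 & 1 & 1 & 1 & 1 \\ 1 & 1 & 1 & \omega & \omega & \omega & \omega^2 & \omega^2 & \omega^2 \\ 1 & 1 & 1 & \omega^2 & \omega^2 & \omega^2 & \omega & \omega & \omega \\ \hline 1 & \omega^2 & \omega & 1 & \omega^2 & \omega & a & a \omega^2 & a \omega \\ 1 & \omega^2 & \omega & \omega & 1 & \omega^2 & a \omega^2 & a \omega & a \\ 1 & \omega^2 & \omega & \omega^2 & \omega & 1 & a \omega & a & a \omega^2 \\ \hline 1 & \omega & \omega^2 & \overline{a} & \overline{a}\omega & \overline{a}\omega^2 & 1 & \omega & \omega^2 \\ 1 & \omega & \omega^2 & \overline{a}\omega & \overline{a}\omega^2 & \overline{a} & \omega^2 & 1 & \omega \\ 1 & \omega & \omega^2 & \overline{a}\omega^2 & \overline{a} & \overline{a}\omega & \omega & \omega^2 & 1 \end{array} \right].\] A complex Hadamard matrix of order $9$ is a matrix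 $H\in\mathbb{C}^{9\times 9}$ all of whose entries have modulus $1$ and which satisfies $HH^\ast=9I$. Two matrices $G,K\in\mathbb{C}^{9\times 9}$ are called equivalent if $K=PDGD^\ast P^T$ for some permutation matrix $P$ and some unitary diagonal matrix $D$. Theorem. Every self-adjoint complex Hadamard matrix $H$ of order $9$ whose diagonal entries are all equal to $1$ is equivalent to $H_9^{(1)}(a)$ for some $a\in\mathbb{C}$ with $|a|=1$. -/

import Mathlib

namespace EquiangularFrames

/-- Equivalence of square complex matrices by `G ↦ P D G D* Pᵀ`, with `P` a permutation matrix and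
`D` a unitary diagonal matrix. -/
def Equivalent {n : Type*} [Fintype n] [DecidableEq n] (G K : Matrix n n ℂ) : Prop :=
  ∃ (σ : Equiv.Perm n) (d : n → ℂ), (∀ i, ‖d i‖ = 1) ∧
    K = σ.permMatrix ℂ * Matrix.diagonal d * G *
      (Matrix.diagonal d).conjTranspose * (σ.permMatrix ℂ).transpose

/-- The principal cube root of unity `-1/2 + i √3/2`. -/
noncomputable def ω : ℂ := -1 / 2 + Complex.I * (Real.sqrt 3 : ℂ) / 2

/-- The one-parameter family of matrices of order 9 (used for `‖a‖ = 1`). -/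
noncomputable def H9 (a : ℂ) : Matrix (Fin 9) (Fin 9) ℂ :=
  !![1, 1, 1, 1, 1, 1, 1, 1, 1;
     1, 1, 1, ω, ω, ω, ω ^ 2, ω ^ 2, ω ^ 2;
     1, 1, 1, ω ^ 2, ω ^ 2, ω ^ 2, ω, ω, ω;
     1, ω ^ 2, ω, 1, ω ^ 2, ω, a, a * ω ^ 2, a * ω;
     1, ω ^ 2, ω, ω, 1, ω ^ 2, a * ω ^ 2, a * ω, a;
     1, ω ^ 2, ω, ω ^ 2, ω, 1, a * ω, a, a * ω ^ 2;
     1, ω, ω ^ 2, star a, star a * ω, star a * ω ^ 2, 1, ω, ω ^ 2;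
     1, ω, ω ^ 2, star a * ω, star a * ω ^ 2, star a, ω ^ 2, 1, ω;
     1, ω, ω ^ 2, star a * ω ^ 2, star a, star a * ω, ω, ω ^ 2, 1]

end EquiangularFrames

namespace EquiangularFrames

open Matrix Finset
open scoped Kronecker ComplexOrder

/-! Since `H ^ 2 = 9` and `tr H = 9`, the matrix `A = 3 - H` satisfies `A ^ 2 = 6 A` and has rank 3:
it is the Gram matrix of nine equiangular lines in `ℂ³`, a SIC. Such lines form a projective
2-design, and this forces the entrywise square of `H` to be a matrix of the same kind
(`IsSIC.entrywise_sq`). Applying this twice to a normalized `H`, every row other than the constant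
one has vanishing power sums of orders 1, 2 and 4. By Newton's identities and unimodularity, the
polynomial with the row entries as roots is then a polynomial in `y ^ 3`, so the row is closed under
multiplication by `ω` (`exists_eq_ω_mul`).

This yields three linearly dependent lines, that is, a triple product `H k l * H l m * H m k = 1`
(`IsSIC.exists_collinear`): either a row contains an extra `1`, or an `ω`-orbit in it gives the
triple through a 4 by 4 Gram determinant. Normalizing at such a triple fixes three rows up to a
permutation. Orthogonality, with the equality case of the triangle inequality, then determines
everything but one unimodular entry (`IsAligned.eq_H9`). -/

/-- A self-adjoint complex Hadamard matrix of order `9` with constant diagonal `1`. -/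
structure IsSIC (H : Matrix (Fin 9) (Fin 9) ℂ) : Prop where
  star_apply : ∀ i j, star (H i j) = H j i
  mul_swap : ∀ i j, H i j * H j i = 1
  diag : ∀ i, H i i = 1
  sq : H * H = (9 : ℂ) • (1 : Matrix (Fin 9) (Fin 9) ℂ)

theorem isSIC_of_isHadamard {H : Matrix (Fin 9) (Fin 9) ℂ} (hHad : H.IsHadamard)
    (hself : H.IsHermitian) (hdiag : ∀ i, H i i = 1) : IsSIC H where
  star_apply i j := hself.apply j i
  mul_swap i j := by
    rw [← hself.apply j i]
    exact (Unitary.mem_iff.1 (hHad.apply_mem i j)).2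
  diag := hdiag
  sq := by
    have := hHad.mul_conjTranspose
    rw [hself.eq] at this
    simpa using this

/-! ### The 2-design identity and entrywise squares. -/

section Squaring

variable {n : Type*} [Fintype n] [DecidableEq n]

/-- The swap matrix on a tensor square. -/
def swapMatrix (n : Type*) [DecidableEq n] : Matrix (n × n) (n × n) ℂ :=
  fun p q => if p.1 = q.2 ∧ p.2 = q.1 then 1 else 0

/-- The projection of the tensor square onto the span of the `eᵢ ⊗ eᵢ`. -/
def diagMatrix (n : Type*) [DecidableEq n] : Matrix (n × n) (n × n) ℂ :=
  diagonal fun p => if p.1 = p.2 then 1 else 0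

theorem swapMatrix_mul_apply (M : Matrix (n × n) (n × n) ℂ) (p q : n × n) :
    (swapMatrix n * M) p q = M p.swap q := by
  rw [mul_apply, Finset.sum_eq_single p.swap]
  · simp [swapMatrix]
  · rintro ⟨b, c⟩ - h
    have : ¬ (p.1 = c ∧ p.2 = b) := fun h' => h (by ext <;> simp [h'.1, h'.2])
    simp [swapMatrix, this]
  · simp

theorem mul_swapMatrix_apply (M : Matrix (n × n) (n × n) ℂ) (p q : n × n) :
    (M * swapMatrix n) p q = M p q.swap := by
  rw [mul_apply, Finset.sum_eq_single q.swap]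
  · simp [swapMatrix]
  · rintro ⟨b, c⟩ - h
    have : ¬ (b = q.2 ∧ c = q.1) := fun h' => h (by ext <;> simp [h'.1, h'.2])
    simp [swapMatrix, this]
  · simp

theorem swapMatrix_mul_self : swapMatrix n * swapMatrix n = 1 := by
  ext p q
  rw [swapMatrix_mul_apply]
  simp only [swapMatrix, one_apply, Prod.ext_iff, Prod.fst_swap, Prod.snd_swap]
  congr 1
  exact propext and_comm

theorem swapMatrix_mul_diagMatrix : swapMatrix n * diagMatrix n = diagMatrix n := by
  ext ⟨a, b⟩ ⟨c, d⟩
  rw [swapMatrix_mul_apply]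
  simp only [diagMatrix, diagonal_apply, Prod.mk.injEq, Prod.swap_prod_mk]
  split_ifs <;> grind

theorem diagMatrix_mul_swapMatrix : diagMatrix n * swapMatrix n = diagMatrix n := by
  ext ⟨a, b⟩ ⟨c, d⟩
  rw [mul_swapMatrix_apply]
  simp only [diagMatrix, diagonal_apply, Prod.mk.injEq, Prod.swap_prod_mk]
  split_ifs <;> grind

theorem swapMatrix_mul_kronecker (A : Matrix n n ℂ) :
    swapMatrix n * (A ⊗ₖ A) = (A ⊗ₖ A) * swapMatrix n := by
  ext ⟨a, b⟩ ⟨c, d⟩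
  rw [swapMatrix_mul_apply, mul_swapMatrix_apply]
  simp [mul_comm]

theorem trace_diagMatrix_mul (M : Matrix (n × n) (n × n) ℂ) :
    (diagMatrix n * M).trace = ∑ i, M (i, i) (i, i) := by
  simp [trace, diagMatrix, diagonal_mul, Fintype.sum_prod_type]

theorem kronecker_diag_kronecker_apply (A : Matrix n n ℂ) (p q : n × n) :
    ((A ⊗ₖ A) * diagMatrix n * (A ⊗ₖ A)) p q =
      ∑ i, A p.1 i * A p.2 i * (A i q.1 * A i q.2) := by
  rw [mul_apply]
  simp [diagMatrix, mul_diagonal, Fintype.sum_prod_type]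

end Squaring

/-- This is the `((i, i), (k, k))` entry of the 2-design identity `K D K = 3 (K + S K)`, where `K =
A ⊗ A`, `S` is the swap and `D` the projection onto the diagonal tensors. -/
theorem IsSIC.sum_sq_mul_sq {H : Matrix (Fin 9) (Fin 9) ℂ} (h : IsSIC H) (i k : Fin 9) :
    ∑ j, ((3 : ℂ) • (1 : Matrix (Fin 9) (Fin 9) ℂ) - H) i j ^ 2 *
      ((3 : ℂ) • (1 : Matrix (Fin 9) (Fin 9) ℂ) - H) j k ^ 2 =
    6 * ((3 : ℂ) • (1 : Matrix (Fin 9) (Fin 9) ℂ) - H) i k ^ 2 := by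
  set A := (3 : ℂ) • (1 : Matrix (Fin 9) (Fin 9) ℂ) - H with hA
  have hAA : A * A = (6 : ℂ) • A := by
    simp only [hA, sub_mul, mul_sub, h.sq, smul_mul_assoc, mul_smul_comm, one_mul, mul_one,
      smul_sub, smul_smul]
    module
  have hAH : Aᴴ = A := by
    ext a b
    simp only [hA, conjTranspose_apply, Matrix.sub_apply, Matrix.smul_apply, star_sub,
      h.star_apply, one_apply]
    split_ifs <;> simp_all
  have hdiag : ∀ a, A a a = 2 := fun a => by simp [hA, h.diag]; norm_num
  have hoff : ∀ a b, A a b * A b a = if a = b then 4 else 1 := by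
    intro a b
    split_ifs with hab
    · rw [hab, hdiag]; norm_num
    · simp [hA, one_apply, hab, Ne.symm hab, h.mul_swap]
  set K := A ⊗ₖ A with hK
  set D := diagMatrix (Fin 9)
  set S := swapMatrix (Fin 9)
  have hKK : K * K = (36 : ℂ) • K := by
    rw [hK, ← mul_kronecker_mul, hAA, smul_kronecker, kronecker_smul, smul_smul]; norm_num
  have hSK : S * K = K * S := swapMatrix_mul_kronecker A
  have hSS : S * S = 1 := swapMatrix_mul_self
  have hSD : S * D = D := swapMatrix_mul_diagMatrix
  have hDS : D * S = D := diagMatrix_mul_swapMatrix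
  have hKH : Kᴴ = K := by rw [hK, conjTranspose_kronecker, hAH]
  have hDH : Dᴴ = D := by
    rw [show D = diagonal _ from rfl, diagonal_conjTranspose]
    congr 1
    ext p
    simp [apply_ite star]
  have hSH : Sᴴ = S := by
    ext ⟨a, b⟩ ⟨c, d⟩
    simp only [S, swapMatrix, conjTranspose_apply, eq_comm (a := c), eq_comm (a := d),
      and_comm (a := b = c)]
    split_ifs <;> simp
  have t1 : (D * K * (D * K)).trace = 216 := by
    rw [Matrix.mul_assoc, trace_diagMatrix_mul, ← Matrix.mul_assoc]
    simp only [hK, D, kronecker_diag_kronecker_apply]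
    have : ∀ a b, A a b * A a b * (A b a * A b a) = if a = b then (16 : ℂ) else 1 := by
      intro a b
      rw [mul_mul_mul_comm, hoff]
      split_ifs <;> norm_num
    simp only [this]
    simp [Finset.sum_ite, Finset.filter_ne, Finset.filter_eq]
    norm_num
  have t2 : (D * K).trace = 36 := by
    rw [trace_diagMatrix_mul]
    simp [hK, hdiag]
    norm_num
  have t3 : K.trace = 324 := by
    rw [hK, trace_kronecker]
    simp [trace, hdiag]
    norm_num
  have t4 : (S * K).trace = 108 := by
    simp only [trace, diag_apply, S, swapMatrix_mul_apply, hK, kroneckerMap_apply,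
      Fintype.sum_prod_type, Prod.fst_swap, Prod.snd_swap, hoff]
    simp [Finset.sum_ite, Finset.filter_ne', Finset.filter_eq']
    norm_num
  -- `X` is the defect in the design identity. It is Hermitian, so it vanishes once `tr (X * X) =
  -- 0`; that trace depends only on `t1`–`t4`, hence only on the moduli of the entries of `A`.
  set X := K * D * K - (3 : ℂ) • (K + S * K) with hX
  have hXH : Xᴴ = X := by
    simp only [hX, conjTranspose_sub, conjTranspose_mul, conjTranspose_smul, conjTranspose_add,
      hKH, hDH, hSH, hSK, Matrix.mul_assoc]
    simp
  have e1 : K * D * K * (K * D * K) = (36 : ℂ) • (K * (D * K * (D * K))) := by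
    calc _ = K * D * (K * K) * (D * K) := by simp only [Matrix.mul_assoc]
      _ = _ := by rw [hKK]; simp only [Matrix.mul_assoc, mul_smul_comm, smul_mul_assoc]
  have e2 : K * D * K * (K + S * K) = (72 : ℂ) • (K * (D * K)) := by
    calc _ = K * D * (K * K) + K * D * (K * S) * K := by
          simp only [Matrix.mul_assoc, Matrix.mul_add]
      _ = K * D * (K * K) + K * (D * S) * (K * K) := by
          rw [← hSK]; simp only [Matrix.mul_assoc]
      _ = _ := by
          rw [hDS, hKK]; simp only [Matrix.mul_assoc, mul_smul_comm]; module
  have e3 : (K + S * K) * (K * D * K) = (72 : ℂ) • (K * (D * K)) := by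
    calc _ = (K * K) * (D * K) + S * (K * K) * (D * K) := by
          simp only [Matrix.mul_assoc, Matrix.add_mul]
      _ = (36 : ℂ) • (K * (D * K)) + (36 : ℂ) • ((S * K) * (D * K)) := by
          rw [hKK]; simp only [Matrix.mul_assoc, mul_smul_comm, smul_mul_assoc]
      _ = (36 : ℂ) • (K * (D * K)) + (36 : ℂ) • (K * (S * D * K)) := by
          rw [hSK]; simp only [Matrix.mul_assoc]
      _ = _ := by rw [hSD]; module
  have e4 : (K + S * K) * (K + S * K) = (72 : ℂ) • (K + S * K) := by
    calc _ = K * K + (K * S) * K + S * (K * K) + S * (K * S) * K := by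
          simp only [Matrix.mul_assoc, Matrix.add_mul, Matrix.mul_add]; abel
      _ = K * K + S * (K * K) + S * (K * K) + (S * S) * (K * K) := by
          rw [← hSK]; simp only [Matrix.mul_assoc]
      _ = _ := by
          rw [hSS, hKK, Matrix.one_mul, mul_smul_comm]; module
  have hXX : X * X = (36 : ℂ) • (K * (D * K * (D * K))) - (432 : ℂ) • (K * (D * K))
      + (648 : ℂ) • (K + S * K) := by
    simp only [hX, sub_mul, mul_sub, smul_mul_assoc, mul_smul_comm, e1, e2, e3, e4]
    module
  have f1 : (K * (D * K * (D * K))).trace = 36 * 216 := by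
    rw [trace_mul_comm, ← t1]
    refine Eq.trans ?_ (trace_smul (36 : ℂ) (D * K * (D * K)))
    congr 1
    calc _ = D * K * (D * (K * K)) := by simp only [Matrix.mul_assoc]
      _ = _ := by rw [hKK]; simp only [mul_smul_comm]
  have f2 : (K * (D * K)).trace = 36 * 36 := by
    rw [trace_mul_comm, Matrix.mul_assoc, hKK, mul_smul_comm, trace_smul, t2, smul_eq_mul]
  have tX : (Xᴴ * X).trace = 0 := by
    rw [hXH, hXX, trace_add, trace_sub, trace_smul, trace_smul, trace_smul, trace_add, f1, f2,
      t3, t4]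
    norm_num
  have hX0 : X = 0 := trace_conjTranspose_mul_self_eq_zero_iff.1 tX
  have := congrFun (congrFun hX0 (i, i)) (k, k)
  simp only [hX, Matrix.sub_apply, hK, D, kronecker_diag_kronecker_apply, Matrix.smul_apply,
    Matrix.add_apply, S, swapMatrix_mul_apply, kronecker_apply, Prod.swap_prod_mk,
    Matrix.zero_apply, smul_eq_mul] at this
  simp only [pow_two]
  linear_combination this

/-- Squaring the entries of `3 - H` removes the off-diagonal sign and turns the diagonal `2` into `4
= 1 + 3`. The result is `B + 3`, and `(B + 3) ^ 2 = 6 (B + 3)` is the same as `B ^ 2 = 9`. -/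
theorem IsSIC.entrywise_sq {H : Matrix (Fin 9) (Fin 9) ℂ} (h : IsSIC H) :
    IsSIC (of fun i j => H i j ^ 2) where
  star_apply i j := by simp [← h.star_apply i j]
  mul_swap i j := by
    simp only [of_apply]
    rw [← mul_pow, h.mul_swap, one_pow]
  diag i := by simp [h.diag]
  sq := by
    set B : Matrix (Fin 9) (Fin 9) ℂ := of fun i j => H i j ^ 2 with hB
    have key : ∀ i j, ((3 : ℂ) • (1 : Matrix (Fin 9) (Fin 9) ℂ) - H) i j ^ 2 =
        (B + (3 : ℂ) • (1 : Matrix (Fin 9) (Fin 9) ℂ)) i j := by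
      intro i j
      by_cases hij : i = j
      · subst hij
        simp [hB, h.diag]
        norm_num
      · simp [hB, hij]
    have : (B + (3 : ℂ) • (1 : Matrix (Fin 9) (Fin 9) ℂ)) *
        (B + (3 : ℂ) • (1 : Matrix (Fin 9) (Fin 9) ℂ)) =
        (6 : ℂ) • (B + (3 : ℂ) • (1 : Matrix (Fin 9) (Fin 9) ℂ)) := by
      ext i k
      rw [mul_apply, Matrix.smul_apply, smul_eq_mul, ← key, ← h.sum_sq_mul_sq]
      simp only [key]
    simp only [add_mul, mul_add, smul_mul_assoc, mul_smul_comm, Matrix.one_mul,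
      Matrix.mul_one] at this
    rw [← sub_eq_zero] at this ⊢
    rw [← this]
    module

/-! ### Cube roots of unity and the symmetry of a row. -/

theorem ω_sq_add : ω ^ 2 + ω + 1 = 0 := by
  have h3 : (Real.sqrt 3 : ℂ) ^ 2 = 3 := by
    rw [← Complex.ofReal_pow, Real.sq_sqrt (by norm_num)]; norm_num
  rw [ω]
  linear_combination (Complex.I ^ 2 / 4) * h3 + (3 / 4) * Complex.I_sq

theorem ω_cube : ω ^ 3 = 1 := by linear_combination (ω - 1) * ω_sq_add

theorem ω_ne_one : ω ≠ 1 := by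
  intro h
  have := ω_sq_add
  rw [h] at this
  norm_num at this

theorem ω_ne_zero : ω ≠ 0 := by
  intro h
  have := ω_sq_add
  rw [h] at this
  norm_num at this

theorem star_ω : star ω = ω ^ 2 := by
  have : star ω = -1 - ω := by
    rw [ω]
    apply Complex.ext
    · simp
      norm_num
    · simp
      ring
  rw [this]
  linear_combination -ω_sq_add

/-- The elementary symmetric functions of unimodular numbers are reciprocal up to conjugation. -/
theorem sum_powersetCard_compl {ι : Type*} [Fintype ι] [DecidableEq ι] {x : ι → ℂ}
    (hu : ∀ k, x k * star (x k) = 1) {j m : ℕ} (hjm : j + m = Fintype.card ι) :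
    ∑ t ∈ powersetCard m univ, ∏ i ∈ t, x i =
      (∏ i, x i) * star (∑ t ∈ powersetCard j univ, ∏ i ∈ t, x i) := by
  rw [star_sum, mul_sum]
  refine Finset.sum_bij' (fun t _ => tᶜ) (fun t _ => tᶜ) ?_ ?_ ?_ ?_ ?_
  · intro t ht
    simp only [mem_powersetCard_univ, card_compl] at ht ⊢
    omega
  · intro t ht
    simp only [mem_powersetCard_univ, card_compl] at ht ⊢
    omega
  · simp
  · simp
  · intro t _
    rw [star_prod, ← Finset.prod_mul_prod_compl t x, mul_assoc, ← prod_mul_distrib]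
    simp only [hu, prod_const_one, mul_one]

/-- In Newton's identity for order 4 the unknown third power sum is multiplied by the first
elementary symmetric function, which is zero. -/
theorem esymm_eq_zero_of_psum {σ : Type*} [Fintype σ] {x : σ → ℂ} (h1 : ∑ k, x k = 0)
    (h2 : ∑ k, x k ^ 2 = 0) (h4 : ∑ k, x k ^ 4 = 0) {j : ℕ} (hj : j = 1 ∨ j = 2 ∨ j = 4) :
    ∑ t ∈ powersetCard j univ, ∏ i ∈ t, x i = 0 := by
  have newton := fun k => congrArg (MvPolynomial.aeval x) (MvPolynomial.mul_esymm_eq_sum σ ℂ k)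
  have hp : ∀ k, MvPolynomial.aeval x (MvPolynomial.psum σ ℂ k) = ∑ i, x i ^ k := by
    intro k; simp [MvPolynomial.psum]
  have he : ∀ k, MvPolynomial.aeval x (MvPolynomial.esymm σ ℂ k) =
      ∑ t ∈ powersetCard k univ, ∏ i ∈ t, x i := by
    intro k; simp [MvPolynomial.esymm]
  simp only [map_mul, map_sum, map_pow, map_neg, map_one, map_natCast, he, hp] at newton
  have e1 := newton 1
  have e2 := newton 2
  have e4 := newton 4
  simp only [sum_filter, Finset.Nat.sum_antidiagonal_eq_sum_range_succ_mk,
    Finset.sum_range_succ, Finset.sum_range_zero] at e1 e2 e4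
  norm_num [h1, h2, h4] at e1 e2 e4
  simp only [e1] at e4
  norm_num at e4
  rcases hj with rfl | rfl | rfl <;> assumption

/-- Orders 1, 2, 4 vanish by Newton and 8, 7, 5 by reciprocity, so only powers of `y ^ 3` survive in
`∏ (y - x i)` and `ω` permutes its roots. -/
theorem exists_eq_ω_mul {x : Fin 9 → ℂ} (hu : ∀ k, x k * star (x k) = 1) (h1 : ∑ k, x k = 0)
    (h2 : ∑ k, x k ^ 2 = 0) (h4 : ∑ k, x k ^ 4 = 0) (k : Fin 9) : ∃ l, x l = ω * x k := by
  have hz := fun j hj => esymm_eq_zero_of_psum (j := j) h1 h2 h4 hj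
  have hz' : ∀ j m, j = 1 ∨ j = 2 ∨ j = 4 → j + m = 9 →
      ∑ t ∈ powersetCard m univ, ∏ i ∈ t, x i = 0 := by
    intro j m hj hjm
    rw [sum_powersetCard_compl hu (j := j) (by simpa using hjm), hz j hj]
    simp
  have expand : ∀ y : ℂ, ∏ i, (y - x i) = ∑ j ∈ range 10,
      (-1) ^ j * ((∑ t ∈ powersetCard j univ, ∏ i ∈ t, x i) * y ^ (9 - j)) := by
    intro y
    have := congrArg (Polynomial.eval y) (Multiset.prod_X_sub_X_eq_sum_esymm (univ.val.map x))
    simp only [Multiset.map_map, Function.comp_def, Finset.esymm_map_val] at this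
    rw [← Finset.prod_eq_multiset_prod] at this
    simpa [Polynomial.eval_prod, Polynomial.eval_finsetSum] using this
  have inv : ∏ i, (ω * x k - x i) = ∏ i, (x k - x i) := by
    rw [expand, expand]
    simp only [Finset.sum_range_succ, Finset.sum_range_zero, hz 1 (by simp), hz 2 (by simp),
      hz 4 (by simp), hz' 4 5 (by simp) rfl, hz' 2 7 (by simp) rfl, hz' 1 8 (by simp) rfl,
      mul_pow]
    have h6 : ω ^ 6 = 1 := by linear_combination (ω ^ 3 + 1) * ω_cube
    have h9 : ω ^ 9 = 1 := by linear_combination (ω ^ 6 + ω ^ 3 + 1) * ω_cube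
    norm_num [h6, h9, ω_cube]
  rw [Finset.prod_eq_zero (f := fun i => x k - x i) (mem_univ k) (sub_self _),
    Finset.prod_eq_zero_iff] at inv
  obtain ⟨l, -, hl⟩ := inv
  exact ⟨l, (sub_eq_zero.1 hl).symm⟩

/-! ### Existence of a linearly dependent triple. -/

namespace IsSIC

variable {H : Matrix (Fin 9) (Fin 9) ℂ}

theorem sum_mul (h : IsSIC H) {i j : Fin 9} (hij : i ≠ j) : ∑ k, H i k * H k j = 0 := by
  have := congrFun (congrFun h.sq i) j
  simpa [mul_apply, hij] using this

theorem submatrix (h : IsSIC H) (e : Equiv.Perm (Fin 9)) : IsSIC (H.submatrix e e) where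
  star_apply i j := h.star_apply _ _
  mul_swap i j := h.mul_swap _ _
  diag i := h.diag _
  sq := by
    rw [Matrix.submatrix_mul_equiv, h.sq, submatrix_smul, Pi.smul_apply, Pi.smul_apply,
      submatrix_one_equiv]

theorem normalize (h : IsSIC H) (i : Fin 9) : IsSIC (of fun a b => H i a * H a b * H b i) where
  star_apply a b := by
    simp only [of_apply, star_mul', h.star_apply]
    ring
  mul_swap a b := by
    simp only [of_apply]
    linear_combination (H a b * H b a * H i a * H a i) * h.mul_swap i b +
      (H a b * H b a) * h.mul_swap i a + h.mul_swap a b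
  diag a := by
    simp only [of_apply, h.diag]
    rw [mul_one, h.mul_swap]
  sq := by
    have key : (of fun a b => H i a * H a b * H b i : Matrix (Fin 9) (Fin 9) ℂ) =
        diagonal (fun a => H i a) * H * diagonal (fun a => H a i) := by
      ext a b
      simp [diagonal_mul, mul_diagonal]
    have hd : diagonal (fun a => H a i) * diagonal (fun a => H i a) = 1 := by
      simp [diagonal_mul_diagonal, h.mul_swap]
    have hd' : diagonal (fun a => H i a) * diagonal (fun a => H a i) = 1 := by
      simp [diagonal_mul_diagonal, h.mul_swap]
    rw [key]
    calc _ = diagonal (fun a => H i a) * (H * (diagonal (fun a => H a i) *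
          diagonal (fun a => H i a)) * H) * diagonal (fun a => H a i) := by
            simp only [Matrix.mul_assoc]
      _ = _ := by
        rw [hd, Matrix.mul_one, h.sq, mul_smul_comm, smul_mul_assoc, Matrix.mul_one, hd']

theorem posSemidef (h : IsSIC H) : ((3 : ℂ) • (1 : Matrix (Fin 9) (Fin 9) ℂ) - H).PosSemidef := by
  set A := (3 : ℂ) • (1 : Matrix (Fin 9) (Fin 9) ℂ) - H with hA
  have hAH : Aᴴ = A := by
    have : Hᴴ = H := by
      ext a b
      exact h.star_apply b a
    rw [hA, conjTranspose_sub, this]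
    simp
  have hAA : A = (1 / 6 : ℝ) • (Aᴴ * A) := by
    rw [hAH]
    simp only [hA, sub_mul, mul_sub, h.sq, smul_mul_assoc, mul_smul_comm, one_mul, mul_one,
      smul_sub, smul_smul]
    ext a b
    simp
    ring
  rw [hAA]
  exact (posSemidef_conjTranspose_mul_self A).smul (by norm_num)

end IsSIC

theorem det_gram_four {a a' z z' : ℂ} (ha : a * a' = 1) (hz : z * z' = 1) :
    (!![2, -1, -1, -1; -1, 2, -a, -(ω * a); -1, -a', 2, -z; -1, -(ω ^ 2 * a'), -z', 2] :
      Matrix (Fin 4) (Fin 4) ℂ).det =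
    -((1 - a * ω ^ 2) * (1 - a' * ω)) * ((1 - z * ω) * (1 - z' * ω ^ 2)) := by
  have hω := ω_sq_add
  simp only [det_succ_row_zero (n := 3), det_fin_three, Fin.sum_univ_succ, Matrix.submatrix_apply]
  simp [Fin.succAbove]
  grind

/-- The Gram determinant of the four lines is nonnegative, yet it equals minus a product of two
squared moduli. The first is nonzero because `H j k ≠ ω`, so the second vanishes. -/
theorem IsSIC.apply_eq_of_eq_ω_mul {H : Matrix (Fin 9) (Fin 9) ℂ} (h : IsSIC H) {i j k l : Fin 9}
    (hi : ∀ a, H i a = 1) (hij : i ≠ j) (hik : i ≠ k) (hil : i ≠ l) (hjk : j ≠ k) (hjl : j ≠ l)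
    (hkl : k ≠ l) (hx : H j l = ω * H j k) (h3 : H j k ^ 3 ≠ 1) : H k l = ω ^ 2 := by
  have hi' : ∀ a, H a i = 1 := fun a => by rw [← h.star_apply i a, hi]; simp
  have hps := h.posSemidef.submatrix ![i, j, k, l]
  have hx' : H l j = ω ^ 2 * H k j := by
    rw [← h.star_apply j l, hx, star_mul', h.star_apply, star_ω]
  have hM : ((3 : ℂ) • (1 : Matrix (Fin 9) (Fin 9) ℂ) - H).submatrix ![i, j, k, l] ![i, j, k, l] =
      !![2, -1, -1, -1; -1, 2, -H j k, -(ω * H j k); -1, -H k j, 2, -H k l;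
        -1, -(ω ^ 2 * H k j), -H l k, 2] := by
    ext a b
    fin_cases a <;> fin_cases b <;>
      simp [hi, hi', h.diag, hij, hik, hil, hjk, hjl, hkl, hij.symm, hik.symm, hil.symm,
        hjk.symm, hjl.symm, hkl.symm, hx, hx'] <;> norm_num
  rw [hM] at hps
  have hdet := hps.det_nonneg
  rw [det_gram_four (h.mul_swap _ _) (h.mul_swap _ _)] at hdet
  have s1 : star (1 - H j k * ω ^ 2) = 1 - H k j * ω := by
    simp only [star_sub, star_mul', star_pow, star_ω, h.star_apply, star_one]
    linear_combination (-H k j * ω) * ω_cube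
  have s2 : star (1 - H k l * ω) = 1 - H l k * ω ^ 2 := by
    simp only [star_sub, star_mul', star_ω, h.star_apply, star_one]
  have n1 : 1 - H j k * ω ^ 2 ≠ 0 := by
    intro h0
    apply h3
    have : H j k = ω := by linear_combination -ω * h0 - (H j k) * ω_cube
    rw [this, ω_cube]
  rw [← s1, ← s2, Complex.star_def, Complex.mul_conj, Complex.mul_conj,
    ← Complex.ofReal_neg, ← Complex.ofReal_mul, Complex.zero_le_real] at hdet
  have p1 := Complex.normSq_pos.2 n1
  have p2 : Complex.normSq (1 - H k l * ω) ≤ 0 := by nlinarith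
  have := Complex.normSq_eq_zero.1 (le_antisymm p2 (Complex.normSq_nonneg _))
  linear_combination -ω ^ 2 * this - H k l * ω_cube

namespace IsSIC

variable {H : Matrix (Fin 9) (Fin 9) ℂ}

theorem sum_row_pow (h : IsSIC H) {i j : Fin 9} (hi : ∀ a, H i a = 1) (hij : i ≠ j) :
    ∑ k, H j k = 0 ∧ ∑ k, H j k ^ 2 = 0 ∧ ∑ k, H j k ^ 4 = 0 := by
  have hi' : ∀ a, H a i = 1 := fun a => by rw [← h.star_apply i a, hi]; simp
  have s1 := h.sum_mul hij.symm
  have s2 := h.entrywise_sq.sum_mul hij.symm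
  have s4 := h.entrywise_sq.entrywise_sq.sum_mul hij.symm
  simp only [of_apply, hi', one_pow, mul_one, ← pow_mul] at s1 s2 s4
  exact ⟨s1, s2, s4⟩

/-- If all entries were cube roots of unity with `1` only at `i` and `j`, the sum of `1 + x + x ^ 2`
along the row would be `6`; the power sums make it `9`. -/
theorem exists_eq_one_or_pow_ne_one (h : IsSIC H) {i j : Fin 9} (hi : ∀ a, H i a = 1)
    (hij : i ≠ j) : (∃ k, k ≠ i ∧ k ≠ j ∧ H j k = 1) ∨ ∃ k, H j k ^ 3 ≠ 1 := by
  have hi' : ∀ a, H a i = 1 := fun a => by rw [← h.star_apply i a, hi]; simp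
  by_contra! hcon
  obtain ⟨hne, h3⟩ := hcon
  obtain ⟨s1, s2, -⟩ := h.sum_row_pow hi hij
  have key : ∀ k, 1 + H j k + H j k ^ 2 = if k = i ∨ k = j then 3 else 0 := by
    intro k
    split_ifs with hk
    · have : H j k = 1 := by
        rcases hk with rfl | rfl
        · exact hi' j
        · exact h.diag k
      rw [this]; norm_num
    · rw [not_or] at hk
      have := sub_ne_zero.2 (hne k hk.1 hk.2)
      apply mul_left_cancel₀ this
      linear_combination h3 k
  have hs : ∑ k, (1 + H j k + H j k ^ 2) = 9 := by
    rw [sum_add_distrib, sum_add_distrib, s1, s2]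
    simp
  simp only [key] at hs
  rw [← Finset.sum_filter, Finset.filter_or, Finset.filter_eq', Finset.filter_eq'] at hs
  simp [hij] at hs
  norm_num at hs

theorem exists_collinear (h : IsSIC H) :
    ∃ k l m, k ≠ l ∧ k ≠ m ∧ l ≠ m ∧ H k l * H l m * H m k = 1 := by
  have hK := h.normalize 0
  set K : Matrix (Fin 9) (Fin 9) ℂ := of fun a b => H 0 a * H a b * H b 0 with hKdef
  have hi : ∀ a, K 0 a = 1 := fun a => by simp [hKdef, h.diag, h.mul_swap]
  have hij : (0 : Fin 9) ≠ 1 := by decide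
  rcases hK.exists_eq_one_or_pow_ne_one hi hij with ⟨k, hk0, hk1, hk⟩ | ⟨k, hk⟩
  · refine ⟨0, 1, k, hij, hk0.symm, hk1.symm, ?_⟩
    simpa [hKdef] using hk
  have hi' : ∀ a, K a 0 = 1 := fun a => by rw [← hK.star_apply 0 a, hi]; simp
  obtain ⟨s1, s2, s4⟩ := hK.sum_row_pow hi hij
  have rot := exists_eq_ω_mul (x := K 1)
    (fun a => by rw [hK.star_apply, hK.mul_swap]) s1 s2 s4
  obtain ⟨l, hl⟩ := rot k
  obtain ⟨m, hm⟩ := rot l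
  have hkm : K 1 k = ω * K 1 m := by
    rw [hm, hl]
    linear_combination (-K 1 k) * ω_cube
  have cube : ∀ a b, K 1 a = ω * K 1 b → K 1 b ^ 3 ≠ 1 → K 1 a ^ 3 ≠ 1 := by
    intro a b hab hb
    rwa [hab, mul_pow, ω_cube, one_mul]
  have hl3 := cube l k hl hk
  have hm3 := cube m l hm hl3
  have h0 : ∀ a, K 1 a ^ 3 ≠ 1 → 0 ≠ a := by
    rintro a ha rfl
    exact ha (by rw [hi', one_pow])
  have h1 : ∀ a, K 1 a ^ 3 ≠ 1 → 1 ≠ a := by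
    rintro a ha rfl
    exact ha (by rw [hK.diag, one_pow])
  have hne : ∀ a b, K 1 b = ω * K 1 a → a ≠ b := by
    rintro a b hab rfl
    have h00 : K 1 a ≠ 0 := left_ne_zero_of_mul_eq_one (hK.mul_swap 1 a)
    exact ω_ne_one (mul_right_cancel₀ h00 (by rw [one_mul, ← hab]))
  have app : ∀ a b, K 1 b = ω * K 1 a → K 1 a ^ 3 ≠ 1 → K 1 b ^ 3 ≠ 1 → K a b = ω ^ 2 :=
    fun a b hab ha hb => hK.apply_eq_of_eq_ω_mul hi hij (h0 a ha) (h0 b hb) (h1 a ha) (h1 b hb)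
      (hne a b hab) hab ha
  have e1 := app k l hl hk hl3
  have e2 := app l m hm hl3 hm3
  have e3 := app m k hkm hm3 hk
  refine ⟨k, l, m, hne k l hl, (hne m k hkm).symm, hne l m hm, ?_⟩
  -- Each factor is `ω ^ 2`. Triple products are invariant under the diagonal normalization, so the
  -- relation passes back to `H`.
  have prod : K k l * K l m * K m k = 1 := by
    rw [e1, e2, e3]
    linear_combination (ω ^ 3 + 1) * ω_cube
  simp only [hKdef, of_apply] at prod
  have m1 := h.mul_swap 0 k
  have m2 := h.mul_swap 0 l
  have m3 := h.mul_swap 0 m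
  have : (H 0 k * H k 0) * (H 0 l * H l 0) * (H 0 m * H m 0) * (H k l * H l m * H m k) = 1 := by
    linear_combination prod
  rwa [m1, m2, m3, one_mul, one_mul, one_mul] at this

end IsSIC

/-! ### Rigidity around a dependent triple. -/

theorem eq_ω_of_one_add_add_eq_zero {u v : ℂ} (hu : u * star u = 1) (hv : v * star v = 1)
    (h : 1 + u + v = 0) : (u = ω ∧ v = ω ^ 2) ∨ (u = ω ^ 2 ∧ v = ω) := by
  have h' : 1 + star u + star v = 0 := by
    simpa only [star_add, star_one, star_zero] using congrArg star h
  have huv : u * v = 1 := by linear_combination u * v * h' - v * hu - u * hv - h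
  have : (u - ω) * (u - ω ^ 2) = 0 := by
    linear_combination (-u) * ω_sq_add + u * h - huv + ω_cube
  rcases mul_eq_zero.1 this with h1 | h1
  · exact Or.inl ⟨sub_eq_zero.1 h1, by linear_combination h - h1 - ω_sq_add⟩
  · exact Or.inr ⟨sub_eq_zero.1 h1, by linear_combination h - h1 - ω_sq_add⟩

/-- Equality case of the triangle inequality: the squared distances of `u`, `v`, `w` from `c` add up
to zero. -/
theorem eq_of_add_add_eq_three_mul {u v w c : ℂ} (hu : u * star u = 1) (hv : v * star v = 1)
    (hw : w * star w = 1) (hc : c * star c = 1) (h : u + v + w = 3 * c) : u = c := by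
  have h' : star u + star v + star w = 3 * star c := by
    simpa only [star_add, star_mul', star_ofNat] using congrArg star h
  have key : (u - c) * star (u - c) + (v - c) * star (v - c) + (w - c) * star (w - c) = 0 := by
    simp only [star_sub]
    linear_combination hu + hv + hw - 3 * hc - star c * h - c * h'
  rw [Complex.star_def, Complex.mul_conj, Complex.mul_conj, Complex.mul_conj] at key
  norm_cast at key
  have := Complex.normSq_nonneg (u - c)
  have := Complex.normSq_nonneg (v - c)
  have := Complex.normSq_nonneg (w - c)
  have h0 : Complex.normSq (u - c) = 0 := by linarith
  exact sub_eq_zero.1 (Complex.normSq_eq_zero.1 h0)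

theorem IsSIC.unimodular {H : Matrix (Fin 9) (Fin 9) ℂ} (h : IsSIC H) (i j : Fin 9) :
    H i j * star (H i j) = 1 := by
  rw [h.star_apply, h.mul_swap]

/-- The sum of rows `k`, `l`, `m` has squared norm `27` by orthogonality. Columns `k`, `l`, `m`
already contribute `9` each, leaving nothing for the others. -/
theorem IsSIC.one_add_add_eq_zero {K : Matrix (Fin 9) (Fin 9) ℂ} (h : IsSIC K) {k l m : Fin 9}
    (hkl : k ≠ l) (hkm : k ≠ m) (hlm : l ≠ m) (hk : ∀ a, K k a = 1) (h1 : K l m = 1) {p : Fin 9}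
    (hpk : p ≠ k) (hpl : p ≠ l) (hpm : p ≠ m) : 1 + K l p + K m p = 0 := by
  have hk' : ∀ a, K a k = 1 := fun a => by rw [← h.star_apply k a, hk, star_one]
  have h1' : K m l = 1 := by rw [← h.star_apply l m, h1, star_one]
  have hsq : ∀ a, ∑ q, K a q * K q a = 9 := fun a => by simp [h.mul_swap]
  have hsum : ∑ q, (K k q + K l q + K m q) * (K q k + K q l + K q m) = 27 := by
    have : ∀ q, (K k q + K l q + K m q) * (K q k + K q l + K q m) =
        K k q * K q k + K l q * K q l + K m q * K q m + (K k q * K q l + K k q * K q m +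
          K l q * K q k + K l q * K q m + K m q * K q k + K m q * K q l) := fun q => by ring
    simp only [this, sum_add_distrib, hsq, h.sum_mul hkl, h.sum_mul hkm, h.sum_mul hlm,
      h.sum_mul hkl.symm, h.sum_mul hkm.symm, h.sum_mul hlm.symm]
    norm_num
  have hterm : ∀ q, (K k q + K l q + K m q) * (K q k + K q l + K q m) =
      (Complex.normSq (1 + K l q + K m q) : ℂ) := by
    intro q
    rw [← Complex.mul_conj, ← Complex.star_def, star_add, star_add, h.star_apply, h.star_apply,
      star_one, hk, hk']
  simp only [hterm] at hsum
  norm_cast at hsum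
  have hsub : ({k, l, m, p} : Finset (Fin 9)) ⊆ univ := subset_univ _
  have hle := Finset.sum_le_sum_of_subset_of_nonneg
    (f := fun q => Complex.normSq (1 + K l q + K m q))
    hsub (fun q _ _ => Complex.normSq_nonneg _)
  have n9 : Complex.normSq (1 + 1 + 1) = 9 := by norm_num [Complex.normSq_apply]
  rw [hsum, sum_insert (by simp [hkl, hkm, hpk.symm]), sum_insert (by simp [hlm, hpl.symm]),
    sum_insert (by simp [hpm.symm]), sum_singleton, hk', hk', h.diag, h.diag, h1, h1', n9] at hle
  exact Complex.normSq_eq_zero.1 (le_antisymm (by linarith) (Complex.normSq_nonneg _))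

theorem sum_univ_nine {M : Type*} [AddCommMonoid M] (f : Fin 9 → M) :
    ∑ i, f i = f 0 + f 1 + f 2 + f 3 + f 4 + f 5 + f 6 + f 7 + f 8 := by
  rw [Fin.sum_univ_castSucc, Fin.sum_univ_eight]
  rfl

/-- A matrix whose first row is constant and whose second row is that of `H9 a`. -/
structure IsAligned (K : Matrix (Fin 9) (Fin 9) ℂ) : Prop extends IsSIC K where
  row_zero : ∀ a, K 0 a = 1
  row_one : ∀ a, K 1 a = ![1, 1, 1, ω, ω, ω, ω ^ 2, ω ^ 2, ω ^ 2] a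

namespace IsAligned

variable {K : Matrix (Fin 9) (Fin 9) ℂ}

theorem col_zero (h : IsAligned K) (a : Fin 9) : K a 0 = 1 := by
  rw [← h.star_apply 0 a, h.row_zero, star_one]

theorem col_one (h : IsAligned K) (a : Fin 9) :
    K a 1 = ![1, 1, 1, ω ^ 2, ω ^ 2, ω ^ 2, ω, ω, ω] a := by
  rw [← h.star_apply 1 a, h.row_one]
  have h4 : ω ^ 4 = ω := by linear_combination ω * ω_cube
  fin_cases a <;> simp [-Complex.star_def, star_ω, ← pow_mul, h4]

theorem row_two (h : IsAligned K) (a : Fin 9) :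
    K 2 a = ![1, 1, 1, ω ^ 2, ω ^ 2, ω ^ 2, ω, ω, ω] a := by
  have h12 : K 1 2 = 1 := h.row_one 2
  have key : ∀ p, p ≠ 0 → p ≠ 1 → p ≠ 2 → K 2 p = -1 - K 1 p := fun p h0 h1 h2 => by
    linear_combination h.one_add_add_eq_zero (k := 0) (l := 1) (m := 2) (by decide) (by decide)
      (by decide) h.row_zero h12 h0 h1 h2
  have w1 : -1 - ω = ω ^ 2 := by linear_combination -ω_sq_add
  have w2 : -1 - ω ^ 2 = ω := by linear_combination -ω_sq_add
  have h20 : K 2 0 = 1 := h.col_zero 2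
  have h21 : K 2 1 = 1 := h.col_one 2
  have h22 : K 2 2 = 1 := h.diag 2
  fin_cases a
  · exact h20
  · exact h21
  · exact h22
  all_goals
    refine (key _ (by decide) (by decide) (by decide)).trans ?_
    simp [h.row_one, w1, w2]

theorem col_two (h : IsAligned K) (a : Fin 9) :
    K a 2 = ![1, 1, 1, ω, ω, ω, ω ^ 2, ω ^ 2, ω ^ 2] a := by
  rw [← h.star_apply 2 a, h.row_two]
  have h4 : ω ^ 4 = ω := by linear_combination ω * ω_cube
  fin_cases a <;> simp [-Complex.star_def, star_ω, ← pow_mul, h4]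

/-- The first block sum vanishes by the dependent triple; orthogonality to rows `0` and `1` then
gives two independent linear equations in the other two. -/
theorem sum_blocks (h : IsAligned K) {p : Fin 9} (h0 : p ≠ 0) (h1 : p ≠ 1) (h2 : p ≠ 2) :
    K p 3 + K p 4 + K p 5 = 0 ∧ K p 6 + K p 7 + K p 8 = 0 := by
  have hs : K p 0 + K p 1 + K p 2 = 0 := by
    have := h.one_add_add_eq_zero (k := 0) (l := 1) (m := 2) (by decide) (by decide)
      (by decide) h.row_zero (h.row_one 2) h0 h1 h2
    have := congrArg star this
    simpa only [star_add, h.star_apply, h.col_zero, star_one, star_zero] using this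
  have e0 := h.sum_mul h0
  have e1 := h.sum_mul h1
  rw [sum_univ_nine] at e0 e1
  simp only [h.col_zero, h.col_one, mul_one] at e0 e1 hs
  simp only [Matrix.cons_val] at e0 e1
  have hw := sub_ne_zero.2 ω_ne_one
  have hw0 := ω_ne_zero
  have f1 : ω * (ω - 1) * (K p 3 + K p 4 + K p 5) = 0 := by
    linear_combination e1 - hs - ω * (e0 - hs)
  have f : K p 3 + K p 4 + K p 5 = 0 :=
    (mul_eq_zero.1 f1).resolve_left (mul_ne_zero hw0 hw)
  exact ⟨f, by linear_combination e0 - hs - f⟩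

/-- Swapping `4, 5` or `7, 8` stays within a block, so it preserves alignment while exchanging `ω`
and `ω ^ 2` in the diagonal block. -/
theorem exists_perm (h : IsAligned K) :
    ∃ e : Equiv.Perm (Fin 9), IsAligned (K.submatrix e e) ∧ K (e 3) (e 4) = ω ^ 2 ∧
      K (e 6) (e 7) = ω := by
  have al : ∀ e : Equiv.Perm (Fin 9), e 0 = 0 → e 1 = 1 →
      (∀ a, (![1, 1, 1, ω, ω, ω, ω ^ 2, ω ^ 2, ω ^ 2] : Fin 9 → ℂ) (e a) =
        (![1, 1, 1, ω, ω, ω, ω ^ 2, ω ^ 2, ω ^ 2] : Fin 9 → ℂ) a) →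
      IsAligned (K.submatrix e e) := fun e h0 h1 hv =>
    { h.toIsSIC.submatrix e with
      row_zero := fun a => by rw [submatrix_apply, h0, h.row_zero]
      row_one := fun a => by rw [submatrix_apply, h1, h.row_one, hv] }
  have c1 := (h.sum_blocks (p := 3) (by decide) (by decide) (by decide)).1
  have c2 := (h.sum_blocks (p := 6) (by decide) (by decide) (by decide)).2
  rw [h.diag] at c1 c2
  rcases eq_ω_of_one_add_add_eq_zero (h.unimodular _ _) (h.unimodular _ _) c1 with c1 | c1 <;>
    rcases eq_ω_of_one_add_add_eq_zero (h.unimodular _ _) (h.unimodular _ _) c2 with c2 | c2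
  · exact ⟨Equiv.swap 4 5, al _ (by decide) (by decide)
      (fun a => by fin_cases a <;> rfl), c1.2, c2.1⟩
  · exact ⟨Equiv.swap 4 5 * Equiv.swap 7 8, al _ (by decide) (by decide)
      (fun a => by fin_cases a <;> rfl), c1.2, c2.2⟩
  · exact ⟨1, al _ (by decide) (by decide)
      (fun a => by fin_cases a <;> rfl), c1.1, c2.1⟩
  · exact ⟨Equiv.swap 7 8, al _ (by decide) (by decide)
      (fun a => by fin_cases a <;> rfl), c1.1, c2.2⟩

end IsAligned

theorem IsSIC.exists_isAligned {K : Matrix (Fin 9) (Fin 9) ℂ} (h : IsSIC K) {k l m : Fin 9}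
    (hkl : k ≠ l) (hkm : k ≠ m) (hlm : l ≠ m) (hk : ∀ a, K k a = 1) (h1 : K l m = 1) :
    ∃ e : Equiv.Perm (Fin 9), IsAligned (K.submatrix e e) := by
  have hw1 := ω_ne_one
  have hw2 : ω ^ 2 ≠ 1 := by
    intro h2
    apply hw1
    linear_combination ω_cube - ω * h2
  have hww : ω ≠ ω ^ 2 := by
    intro h2
    apply hw2
    linear_combination ω_cube + ω * h2
  have hlk : K l k = 1 := by rw [← h.star_apply k l, hk, star_one]
  have hll : K l l = 1 := h.diag l
  have hor : ∀ p, p ∉ ({k, l, m} : Finset (Fin 9)) → K l p = ω ∨ K l p = ω ^ 2 := by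
    intro p hp
    simp only [mem_insert, mem_singleton, not_or] at hp
    rcases eq_ω_of_one_add_add_eq_zero (h.unimodular _ _) (h.unimodular _ _)
      (h.one_add_add_eq_zero hkl hkm hlm hk h1 hp.1 hp.2.1 hp.2.2) with h | h
    exacts [Or.inl h.1, Or.inr h.1]
  have hone : ∀ p ∈ ({k, l, m} : Finset (Fin 9)), K l p = 1 := by
    intro p hp
    simp only [mem_insert, mem_singleton] at hp
    rcases hp with rfl | rfl | rfl <;> assumption
  have hcard : ((({k, l, m} : Finset (Fin 9)).card : ℕ) : ℂ) = 3 := by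
    rw [card_eq_three.2 ⟨k, l, m, hkl, hkm, hlm, rfl⟩]; norm_num
  -- Taking `f` to be the identity and the square gives two linear equations for the multiplicities
  -- of `ω` and `ω ^ 2`; both equal `3`.
  have hfun : ∀ f : ℂ → ℂ, ∑ p, f (K l p) = 3 * f 1 +
      (univ.filter fun p => K l p = ω).card * f ω +
      (univ.filter fun p => K l p = ω ^ 2).card * f (ω ^ 2) := by
    intro f
    have : ∀ p, f (K l p) = (if p ∈ ({k, l, m} : Finset (Fin 9)) then f 1 else 0) +
        (if K l p = ω then f ω else 0) + (if K l p = ω ^ 2 then f (ω ^ 2) else 0) := by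
      intro p
      by_cases hp : p ∈ ({k, l, m} : Finset (Fin 9))
      · rw [if_pos hp, hone p hp, if_neg hw1.symm, if_neg hw2.symm]; ring
      · rcases hor p hp with h | h
        · rw [if_neg hp, h, if_pos rfl, if_neg hww]; ring
        · rw [if_neg hp, h, if_pos rfl, if_neg hww.symm]; ring
    simp only [this, sum_add_distrib]
    rw [← Finset.sum_filter, ← Finset.sum_filter, ← Finset.sum_filter]
    simp only [sum_const, nsmul_eq_mul, filter_univ_mem, hcard]
  obtain ⟨s1, s2, -⟩ := h.sum_row_pow hk hkl
  rw [hfun fun x => x] at s1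
  rw [hfun fun x => x ^ 2] at s2
  have hA : ((univ.filter fun p => K l p = ω).card : ℂ) = 3 := by
    apply mul_left_cancel₀ (sub_ne_zero.2 hw2.symm)
    linear_combination ω ^ 2 * s1 - s2 - (#{p | K l p = ω} : ℂ) * ω_cube
  have hB : ((univ.filter fun p => K l p = ω ^ 2).card : ℂ) = 3 := by
    apply mul_left_cancel₀ (pow_ne_zero 2 ω_ne_zero)
    linear_combination s1 - ω * hA - 3 * ω_sq_add
  obtain ⟨p, q, r, hpq, hpr, hqr, hS⟩ := card_eq_three.1 (Nat.cast_injective hA : _ = 3)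
  obtain ⟨s, t, u, hst, hsu, htu, hT⟩ := card_eq_three.1 (Nat.cast_injective hB : _ = 3)
  have mS : ∀ x, x = p ∨ x = q ∨ x = r → K l x = ω := by
    intro x hx
    have : x ∈ (univ.filter fun p => K l p = ω) := by rw [hS]; simpa using hx
    simpa using this
  have mT : ∀ x, x = s ∨ x = t ∨ x = u → K l x = ω ^ 2 := by
    intro x hx
    have : x ∈ (univ.filter fun p => K l p = ω ^ 2) := by rw [hT]; simpa using hx
    simpa using this
  have kp := mS p (by simp)
  have kq := mS q (by simp)
  have kr := mS r (by simp)
  have ks := mT s (by simp)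
  have kt := mT t (by simp)
  have ku := mT u (by simp)
  have ne : ∀ {x y a b}, K l x = a → K l y = b → a ≠ b → x ≠ y := by
    rintro x y a b hx hy hab rfl
    exact hab (hx.symm.trans hy)
  have hinj : Function.Injective ![k, l, m, p, q, r, s, t, u] := by
    have := ne hlk kp hw1.symm
    have := ne hlk kq hw1.symm
    have := ne hlk kr hw1.symm
    have := ne hlk ks hw2.symm
    have := ne hlk kt hw2.symm
    have := ne hlk ku hw2.symm
    have := ne hll kp hw1.symm
    have := ne hll kq hw1.symm
    have := ne hll kr hw1.symm
    have := ne hll ks hw2.symm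
    have := ne hll kt hw2.symm
    have := ne hll ku hw2.symm
    have := ne h1 kp hw1.symm
    have := ne h1 kq hw1.symm
    have := ne h1 kr hw1.symm
    have := ne h1 ks hw2.symm
    have := ne h1 kt hw2.symm
    have := ne h1 ku hw2.symm
    have := ne kp ks hww
    have := ne kp kt hww
    have := ne kp ku hww
    have := ne kq ks hww
    have := ne kq kt hww
    have := ne kq ku hww
    have := ne kr ks hww
    have := ne kr kt hww
    have := ne kr ku hww
    rw [← List.nodup_ofFn]
    simp only [List.ofFn_succ, List.ofFn_zero]
    simp [*]
  refine ⟨Equiv.ofBijective _ (Finite.injective_iff_bijective.1 hinj), { h.submatrix _ with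
    row_zero := fun a => ?_
    row_one := fun a => ?_ }⟩
  · exact hk _
  · fin_cases a <;> assumption

/-! ### Identification with the family, and conclusion. -/

theorem IsAligned.eq_H9 {K : Matrix (Fin 9) (Fin 9) ℂ} (h : IsAligned K) (h34 : K 3 4 = ω ^ 2)
    (h67 : K 6 7 = ω) : K = H9 (K 3 6) := by
  have w4 : ω ^ 4 = ω := by linear_combination ω * ω_cube
  have hs : star (ω ^ 2) = ω := by rw [star_pow, star_ω, ← pow_mul, w4]
  have low : ∀ {i j : Fin 9} {z : ℂ}, K i j = z → K j i = star z := fun {i j z} hz => by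
    rw [← hz, h.star_apply]
  have uω : ω * star ω = 1 := by rw [star_ω]; linear_combination ω_cube
  have uω2 : ω ^ 2 * star (ω ^ 2) = 1 := by rw [hs]; linear_combination ω_cube
  have B := fun p h0 h1 h2 => h.sum_blocks (p := p) h0 h1 h2
  have b3 := B 3 (by decide) (by decide) (by decide)
  have b4 := B 4 (by decide) (by decide) (by decide)
  have b5 := B 5 (by decide) (by decide) (by decide)
  have b6 := B 6 (by decide) (by decide) (by decide)
  have b7 := B 7 (by decide) (by decide) (by decide)
  have b8 := B 8 (by decide) (by decide) (by decide)
  have h43 : K 4 3 = ω := (low h34).trans hs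
  have h35 : K 3 5 = ω := by linear_combination b3.1 - h.diag 3 - h34 - ω_sq_add
  have h53 : K 5 3 = ω ^ 2 := (low h35).trans star_ω
  have h45 : K 4 5 = ω ^ 2 := by linear_combination b4.1 - h.diag 4 - h43 - ω_sq_add
  have h54 : K 5 4 = ω := (low h45).trans hs
  have h76 : K 7 6 = ω ^ 2 := (low h67).trans star_ω
  have h68 : K 6 8 = ω ^ 2 := by linear_combination b6.2 - h.diag 6 - h67 - ω_sq_add
  have h86 : K 8 6 = ω := (low h68).trans hs
  have h78 : K 7 8 = ω := by linear_combination b7.2 - h.diag 7 - h76 - ω_sq_add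
  have h87 : K 8 7 = ω ^ 2 := (low h78).trans star_ω
  have um : ∀ i j k, K i j * K j k * star (K i j * K j k) = 1 := fun i j k => by
    rw [star_mul', h.star_apply, h.star_apply]
    linear_combination K j k * K k j * h.mul_swap i j + h.mul_swap j k
  have o34 := h.sum_mul (show (3 : Fin 9) ≠ 4 by decide)
  have o35 := h.sum_mul (show (3 : Fin 9) ≠ 5 by decide)
  have o67 := h.sum_mul (show (6 : Fin 9) ≠ 7 by decide)
  rw [sum_univ_nine] at o34 o35 o67
  simp only [h.col_zero, h.row_zero, h.col_one, h.row_one, h.col_two, h.row_two, h.diag, h34,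
    h35, h45, h54, h67, h68, h87, Matrix.cons_val] at o34 o35 o67
  -- With the diagonal blocks known, orthogonality makes three unimodular products sum to three
  -- times a unimodular number, so each is known. This expresses columns `6` and `7` of the middle
  -- rows through `K 3 6`; block sums give column `8`.
  have c34 := eq_of_add_add_eq_three_mul (um 3 6 4) (um 3 7 4) (um 3 8 4) uω
    (by linear_combination o34 - 2 * ω_cube - 3 * ω_sq_add)
  have c35 := eq_of_add_add_eq_three_mul (um 3 6 5) (um 3 7 5) (um 3 8 5) uω2
    (by linear_combination o35 - 2 * ω_cube - 3 * ω_sq_add - ω * ω_cube)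
  have s67 : K 6 3 * K 3 7 + K 6 4 * K 4 7 + K 6 5 * K 5 7 = 3 * ω ^ 2 := by
    linear_combination o67 - 3 * ω_sq_add - ω * ω_cube - 2 * ω_cube
  have c67a := eq_of_add_add_eq_three_mul (um 6 3 7) (um 6 4 7) (um 6 5 7) uω2 s67
  have c67b := eq_of_add_add_eq_three_mul (um 6 4 7) (um 6 3 7) (um 6 5 7) uω2
    (by linear_combination s67)
  have c67c := eq_of_add_add_eq_three_mul (um 6 5 7) (um 6 3 7) (um 6 4 7) uω2
    (by linear_combination s67)
  set a := K 3 6 with ha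
  have h46 : K 4 6 = a * ω ^ 2 := by
    linear_combination ω ^ 2 * a * h.mul_swap 4 6 - K 4 6 * ω ^ 2 * c34 - K 4 6 * ω_cube
  have h56 : K 5 6 = a * ω := by
    linear_combination ω * a * h.mul_swap 5 6 - K 5 6 * ω * c35 - K 5 6 * ω_cube
  have h37 : K 3 7 = a * ω ^ 2 := by
    linear_combination a * c67a - K 3 7 * h.mul_swap 3 6
  have h47 : K 4 7 = a * ω := by
    linear_combination K 4 6 * c67b - K 4 7 * h.mul_swap 4 6 + ω ^ 2 * h46 + a * ω * ω_cube
  have h57 : K 5 7 = a := by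
    linear_combination K 5 6 * c67c - K 5 7 * h.mul_swap 5 6 + ω ^ 2 * h56 + a * ω_cube
  have h38 : K 3 8 = a * ω := by linear_combination b3.2 - h37 - a * ω_sq_add
  have h48 : K 4 8 = a := by linear_combination b4.2 - h46 - h47 - a * ω_sq_add
  have h58 : K 5 8 = a * ω ^ 2 := by linear_combination b5.2 - h56 - h57 - a * ω_sq_add
  have sω : star (a * ω) = star a * ω ^ 2 := by rw [star_mul', star_ω]
  have sω2 : star (a * ω ^ 2) = star a * ω := by rw [star_mul', hs]
  have h63 : K 6 3 = star a := low ha.symm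
  have h64 := (low h46).trans sω2
  have h65 := (low h56).trans sω
  have h73 := (low h37).trans sω2
  have h74 := (low h47).trans sω
  have h75 := low h57
  have h83 := (low h38).trans sω
  have h84 := low h48
  have h85 := (low h58).trans sω2
  ext i j
  fin_cases i
  · rw [Fin.zero_eta, h.row_zero]
    fin_cases j <;> rfl
  · exact (h.row_one j).trans (by fin_cases j <;> rfl)
  · exact (h.row_two j).trans (by fin_cases j <;> rfl)
  all_goals
    fin_cases j
    · exact h.col_zero _
    · exact h.col_one _
    · exact h.col_two _
    all_goals first
      | exact h.diag _
      | assumption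

theorem permMatrix_conj_apply {n : Type*} [Fintype n] [DecidableEq n] (σ : Equiv.Perm n)
    (M : Matrix n n ℂ) (a b : n) :
    (σ.permMatrix ℂ * M * (σ.permMatrix ℂ).transpose) a b = M (σ a) (σ b) := by
  rw [transpose_permMatrix, Equiv.Perm.permMatrix, Equiv.Perm.permMatrix,
    PEquiv.toMatrix_toPEquiv_mul, PEquiv.mul_toMatrix_toPEquiv]
  rfl

end EquiangularFrames

theorem mainTheorem2 (H : Matrix (Fin 9) (Fin 9) ℂ) (hHad : H.IsHadamard)
    (hself : H.IsHermitian) (hdiag : ∀ i, H i i = 1) :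
    ∃ a : ℂ, ‖a‖ = 1 ∧ EquiangularFrames.Equivalent H (EquiangularFrames.H9 a) := by
  open EquiangularFrames in
  have h := isSIC_of_isHadamard hHad hself hdiag
  obtain ⟨k, l, m, hkl, hkm, hlm, hprod⟩ := h.exists_collinear
  have norm_one : ∀ i j, ‖H i j‖ = 1 := fun i j => by
    have := h.unimodular i j
    rw [Complex.star_def, Complex.mul_conj, Complex.normSq_eq_norm_sq] at this
    norm_cast at this
    exact (pow_eq_one_iff_of_nonneg (norm_nonneg _) two_ne_zero).1 this
  obtain ⟨e, he⟩ := (h.normalize k).exists_isAligned hkl hkm hlm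
    (fun a => by simp [h.diag, h.mul_swap]) hprod
  obtain ⟨f, hf, hf3, hf6⟩ := he.exists_perm
  have hK := hf.eq_H9 hf3 hf6
  -- The diagonal unitary is row `k` of `H`, which performs the normalization at `k`.
  refine ⟨_, ?_, f.trans e, fun a => H k a, fun a => norm_one _ _, hK.symm.trans ?_⟩
  · simp [norm_one]
  · ext a b
    rw [Matrix.mul_assoc (_ * _) H, Matrix.mul_assoc (Equiv.Perm.permMatrix ℂ _),
      permMatrix_conj_apply]
    simp [mul_assoc, Matrix.mul_diagonal, Matrix.diagonal_mul,
      Matrix.diagonal_conjTranspose, ← h.star_apply k]
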